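/- Let $X_1=\partial_x$ and $X_2=x\,\partial_y$ on $\mathbb{R}^2$, and let the Grushin plane be $\mathbb{R}^2$ with the Carnot–Carathéodory distance $d$ of $X_1,X_2$: $d(p,q)$ is the infimum of the lengths $\int_0^1|u(t)|\,dt$ of horizontal curves from $p$ to $q$, i.e. absolutely continuous $\gamma:[0,1]\to\mathbb{R}^2$ with $\gamma(0)=p$, $\gamma(1)=q$ and $\gamma'=u_1X_1(\gamma)+u_2X_2(\gamma)$ almost everywhere for an integrable $u=(u_1,u_2)$. (Off the axis $x=0$ this is the length structure of the Riemannian metric $dx^2+x^{-2}dy^2$; on the axis the horizontal directions are the multiples of $\partial_x$.) **Theorem 4.2.** The Grushin plane $M=(\mathbb{R}^2,d)$ is a 2-dimensional sub-Riemannian manifold (connected and smooth, with $X_1,X_2$ smooth and bracket generating, and with $d$ a finite metric that induces the manifold topology) of Hausdorff dimension 2, and there exist an open set $U\subset M$ and a Lipschitz map $F:U\to\mathbb{R}^2$, where $U$ carries the metric $d$ and $\mathbb{R}^2$ the Euclidean metric, that is not decomposable in the following sense: there is no countable family $\{A_i\}$ of subsets of $U$ such that $$H^2\Big(F\big(U\setminus\textstyle\bigcup_i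 A_i\big)\Big)=0$$ and $F|_{A_i}$ is biLipschitz for every $i$. Here $H^2$ is 2-dimensional Hausdorff measure. -/

import Mathlib

open Set MeasureTheory
open scoped Manifold ContDiff NNReal ENNReal

noncomputable section

namespace SubRiem

section Structure

variable {n : ℕ} {M : Type*} [TopologicalSpace M] [ChartedSpace (EuclideanSpace ℝ (Fin n)) M]
  {ι : Type*}

/-- The iterated Lie brackets `X i`, `[X i, X j]`, `[X i, [X j, X k]]`, ... of a family of vector
fields on the manifold `M`. -/
inductive IsIteratedBracket (X : ι → (p : M) → TangentSpace (𝓡 n) p) :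
    ((p : M) → TangentSpace (𝓡 n) p) → Prop
  | base (i : ι) : IsIteratedBracket X (X i)
  | bracket (V W : (p : M) → TangentSpace (𝓡 n) p) :
      IsIteratedBracket X V → IsIteratedBracket X W →
        IsIteratedBracket X (VectorField.mlieBracket (𝓡 n) V W)

/-- The bracket generating (Hörmander) condition: at each point the iterated Lie brackets of the
family span the whole tangent space. -/
def BracketGenerating (X : ι → (p : M) → TangentSpace (𝓡 n) p) : Prop :=
  ∀ p : M, Submodule.span ℝ {v : TangentSpace (𝓡 n) p | ∃ V, IsIteratedBracket X V ∧ V p = v} = ⊤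

/-- The derivative `df (v)` of the real function `f` in the direction of the tangent vector `v`. -/
def dirDeriv (f : M → ℝ) (p : M) (v : TangentSpace (𝓡 n) p) : ℝ :=
  mfderiv (𝓡 n) 𝓘(ℝ, ℝ) f p v

variable [Fintype ι]

/-- `γ : [0, 1] → M` is a horizontal (admissible) curve for the family `X`, with control `u`:
`γ` is continuous, `u` is integrable, and `γ' = ∑ i, u i • X i (γ)` in the sense of absolutely
continuous curves. The latter is expressed without coordinates, by testing against all smooth
functions `f` on `M`: the function `f ∘ γ` is the integral of
`∑ i, u i * df (X i (γ))`. (Applied to cut-off coordinate functions this says that `γ` is absolutely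
continuous in charts and satisfies the differential equation almost everywhere.) -/
structure IsHorizontal (X : ι → (p : M) → TangentSpace (𝓡 n) p) (γ : ℝ → M)
    (u : ℝ → EuclideanSpace ℝ ι) : Prop where
  continuousOn : ContinuousOn γ (Icc 0 1)
  integrableOn : IntegrableOn u (Icc 0 1)
  integral_eq : ∀ f : M → ℝ, ContMDiff (𝓡 n) 𝓘(ℝ, ℝ) ∞ f → ∀ t ∈ Icc (0 : ℝ) 1,
    f (γ t) - f (γ 0) =
      ∫ s in (0 : ℝ)..t, ∑ i, u s i * dirDeriv f (γ s) (X i (γ s))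

/-- The Carnot–Carathéodory distance: the infimum of the lengths `∫ |u|` of the horizontal curves
from `p` to `q` (and `∞` if there is none). The infimum over the controls `u` accounts for the
minimal norm `|v| = inf {|u| : v = ∑ i, u i • X i p}` of a horizontal vector `v`, so `X` plays the
role of an orthonormal frame, whose rank may vary from point to point. -/
def ccEDist (X : ι → (p : M) → TangentSpace (𝓡 n) p) (p q : M) : ℝ≥0∞ :=
  ⨅ (γ : ℝ → M) (u : ℝ → EuclideanSpace ℝ ι) (_ : IsHorizontal X γ u) (_ : γ 0 = p)
    (_ : γ 1 = q), ∫⁻ t in Icc (0 : ℝ) 1, ‖u t‖ₑ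

end Structure

/-- The `n`-dimensional manifold `M`, with its given metric, is a sub-Riemannian manifold with
(generalized, possibly rank-varying) orthonormal frame `X`: it is a connected smooth manifold, the
vector fields `X i` are smooth and bracket generating, and the metric of `M` (which induces the
manifold topology) is the Carnot–Carathéodory distance. -/
structure IsSubRiemannianManifold {n : ℕ} {M : Type*} [MetricSpace M]
    [ChartedSpace (EuclideanSpace ℝ (Fin n)) M] {ι : Type*} [Fintype ι]
    (X : ι → (p : M) → TangentSpace (𝓡 n) p) : Prop where
  connected : ConnectedSpace M
  isManifold : IsManifold (𝓡 n) ∞ M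
  smooth : ∀ i, ContMDiff (𝓡 n) (𝓡 n).tangent ∞
    (fun p ↦ (⟨p, X i p⟩ : TangentBundle (𝓡 n) M))
  bracketGenerating : BracketGenerating X
  edist_eq : ∀ p q : M, edist p q = ccEDist X p q

/-- The vector fields `∂/∂x` and `x ∂/∂y` on the plane. Away from the axis `x = 0` they are an
orthonormal frame of the Riemannian metric `dx² + x⁻² dy²`; on the axis the horizontal directions
are the multiples of `∂/∂x`. -/
def grushinFrame (i : Fin 2) (p : EuclideanSpace ℝ (Fin 2)) : TangentSpace (𝓡 2) p :=
  (![!₂[1, 0], !₂[0, p 0]] : Fin 2 → EuclideanSpace ℝ (Fin 2)) i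

/-- The family `X` of vector fields makes `M` (a copy of) the Grushin plane: there is a
diffeomorphism `M → ℝ²` that carries `X` to the frame `∂/∂x`, `x ∂/∂y`. -/
def IsGrushin {M : Type*} [TopologicalSpace M] [ChartedSpace (EuclideanSpace ℝ (Fin 2)) M]
    (X : Fin 2 → (p : M) → TangentSpace (𝓡 2) p) : Prop :=
  ∃ φ : M ≃ₘ⟮𝓡 2, 𝓡 2⟯ EuclideanSpace ℝ (Fin 2), ∀ i p,
    mfderiv (𝓡 2) (𝓡 2) φ p (X i p) = grushinFrame i (φ p)

/-- `F` restricted to `A` is biLipschitz. -/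
def BiLipschitzOn {α β : Type*} [PseudoEMetricSpace α] [PseudoEMetricSpace β] (F : α → β)
    (A : Set α) : Prop :=
  ∃ K L : ℝ≥0, LipschitzOnWith K F A ∧ AntilipschitzWith L (A.domRestrict F)

end SubRiem

end

/-!
# A Lipschitz map on the Grushin plane that is not decomposable

On the axis `x = 0` of the Grushin plane the distance between points at heights `s` and `t` is
comparable with `|s - t| ^ (1 / 2)`: a horizontal curve of length `ℓ` that starts on the axis stays
within `ℓ` of it and so rises by at most `ℓ ^ 2` (`abs_sub_le_of_ccEDist_grushin_lt`), while moving
away from the axis by `√|s - t|`, then up, then back, realizes this up to a constant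
(`ccEDist_grushin_le`). So the axis is a snowflake of Hausdorff dimension `2`; as the metric is locally
biLipschitz to the Euclidean one off the axis, the whole plane has dimension `2`.

Since the axis is a snowflake, a `1/2`-Hölder curve is a Lipschitz map on the axis. Pólya's curve
(`exists_holder_curve_filling_triangle`) is such a curve and fills a triangle; its McShane extension
`F` to the plane is the map sought. It is not decomposable, because a set on the axis where it is
biLipschitz has a null image (`measure_image_eq_zero_of_snowflake`): a subset of the plane of positive
measure contains, near a density point, chains of many short steps along a segment, whereas in a
`1/2`-snowflake of the line a chain of `N` steps of size `δ` only reaches distance about `√N * δ`.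
Countably many null sets cannot cover the triangle, whatever happens off the axis.

That the Carnot–Carathéodory distance is a metric follows from reversing and concatenating horizontal
curves. The two-sided estimates in coordinates show that it is finite and induces the Euclidean
topology.
-/

namespace SubRiem

open Filter Topology

/-! ### Concatenation and reversal of horizontal curves -/

/-- The concatenation on `[0, 1]` of two functions on `[0, 1]`, each run at double speed. -/
noncomputable def concat {α : Type*} (f g : ℝ → α) (t : ℝ) : α :=
  if t ≤ 1 / 2 then f (2 * t) else g (2 * t - 1)

theorem concat_of_le {α : Type*} (f g : ℝ → α) {t : ℝ} (ht : t ≤ 1 / 2) :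
    concat f g t = f (2 * t) := if_pos ht

theorem concat_of_gt {α : Type*} (f g : ℝ → α) {t : ℝ} (ht : 1 / 2 < t) :
    concat f g t = g (2 * t - 1) := if_neg (not_le.2 ht)

section Concat

variable {F : Type*} [NormedAddCommGroup F] [NormedSpace ℝ F] {G₁ G₂ : ℝ → F}

theorem intervalIntegrable_two_smul_concat (h₁ : IntervalIntegrable G₁ volume 0 1)
    (h₂ : IntervalIntegrable G₂ volume 0 1) :
    IntervalIntegrable (fun t ↦ (2 : ℝ) • concat G₁ G₂ t) volume 0 1 := by
  refine IntervalIntegrable.smul ?_ 2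
  have e₁ : IntervalIntegrable (fun t ↦ G₁ (2 * t)) volume 0 (1 / 2) := by
    have := h₁.comp_mul_left (c := 2)
    simpa using this
  have e₂ : IntervalIntegrable (fun t ↦ G₂ (2 * t - 1)) volume (1 / 2) 1 := by
    have := (h₂.comp_sub_right 1).comp_mul_left (c := 2)
    convert this using 1 <;> norm_num
  refine IntervalIntegrable.trans (b := 1 / 2) (e₁.congr fun t ht ↦ ?_) (e₂.congr fun t ht ↦ ?_)
  · rw [uIoc_of_le (by norm_num)] at ht
    exact (concat_of_le _ _ ht.2).symm
  · rw [uIoc_of_le (by norm_num)] at ht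
    exact (concat_of_gt _ _ ht.1).symm

theorem integral_two_smul_concat_of_le {t : ℝ} (h0 : 0 ≤ t) (ht : t ≤ 1 / 2) :
    ∫ s in (0 : ℝ)..t, (2 : ℝ) • concat G₁ G₂ s = ∫ s in (0 : ℝ)..(2 * t), G₁ s := by
  have h := intervalIntegral.smul_integral_comp_mul_left (a := 0) (b := t) G₁ 2
  rw [mul_zero] at h
  rw [← h, ← intervalIntegral.integral_smul]
  refine intervalIntegral.integral_congr fun s hs ↦ ?_
  rw [uIcc_of_le h0] at hs
  simp only [concat_of_le _ _ (hs.2.trans ht)]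

theorem integral_two_smul_concat_of_ge (h₁ : IntervalIntegrable G₁ volume 0 1)
    (h₂ : IntervalIntegrable G₂ volume 0 1) {t : ℝ} (ht : 1 / 2 ≤ t) (h1 : t ≤ 1) :
    ∫ s in (0 : ℝ)..t, (2 : ℝ) • concat G₁ G₂ s =
      (∫ s in (0 : ℝ)..1, G₁ s) + ∫ s in (0 : ℝ)..(2 * t - 1), G₂ s := by
  have hI := intervalIntegrable_two_smul_concat h₁ h₂
  rw [← intervalIntegral.integral_add_adjacent_intervals (b := 1 / 2)
    (hI.mono_set (uIcc_subset_uIcc (by simp) (by rw [mem_uIcc]; norm_num)))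
    (hI.mono_set (uIcc_subset_uIcc (by rw [mem_uIcc]; norm_num)
      (by rw [mem_uIcc]; left; constructor <;> linarith))),
    integral_two_smul_concat_of_le (by norm_num) le_rfl]
  congr 1
  · norm_num
  · have h := intervalIntegral.smul_integral_comp_mul_sub (a := 1 / 2) (b := t) G₂ 2 1
    rw [show (2 : ℝ) * (1 / 2) - 1 = 0 by norm_num] at h
    rw [← h, ← intervalIntegral.integral_smul]
    refine intervalIntegral.integral_congr_ae (ae_of_all _ fun s hs ↦ ?_)
    rw [uIoc_of_le ht] at hs
    simp only [concat_of_gt _ _ hs.1]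

end Concat

section Distance

variable {n : ℕ} {M : Type*} [TopologicalSpace M] [ChartedSpace (EuclideanSpace ℝ (Fin n)) M]
  {ι : Type*} [Fintype ι] {X : ι → (p : M) → TangentSpace (𝓡 n) p}

theorem lintegral_enorm_eq_ofReal {u : ℝ → EuclideanSpace ℝ ι} (hu : IntegrableOn u (Icc 0 1)) :
    ∫⁻ t in Icc (0 : ℝ) 1, ‖u t‖ₑ = ENNReal.ofReal (∫ t in (0 : ℝ)..1, ‖u t‖) := by
  rw [← ofReal_integral_norm_eq_lintegral_enorm hu,
    intervalIntegral.integral_of_le zero_le_one, integral_Icc_eq_integral_Ioc]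

theorem IsHorizontal.ccEDist_le {γ : ℝ → M} {u : ℝ → EuclideanSpace ℝ ι}
    (h : IsHorizontal X γ u) :
    ccEDist X (γ 0) (γ 1) ≤ ENNReal.ofReal (∫ t in (0 : ℝ)..1, ‖u t‖) := by
  rw [← lintegral_enorm_eq_ofReal h.integrableOn]
  exact iInf_le_of_le γ (iInf_le_of_le u (iInf_le_of_le h
    (iInf_le_of_le rfl (iInf_le_of_le rfl le_rfl))))

theorem le_ccEDist {p q : M} {c : ℝ≥0∞}
    (H : ∀ γ u, IsHorizontal X γ u → γ 0 = p → γ 1 = q →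
      c ≤ ENNReal.ofReal (∫ t in (0 : ℝ)..1, ‖u t‖)) : c ≤ ccEDist X p q := by
  refine le_iInf fun γ ↦ le_iInf fun u ↦ le_iInf fun h ↦ le_iInf fun h0 ↦ le_iInf fun h1 ↦ ?_
  rw [lintegral_enorm_eq_ofReal h.integrableOn]
  exact H γ u h h0 h1

theorem exists_isHorizontal_of_ccEDist_lt {p q : M} {c : ℝ≥0∞} (h : ccEDist X p q < c) :
    ∃ γ u, IsHorizontal X γ u ∧ γ 0 = p ∧ γ 1 = q ∧
      ENNReal.ofReal (∫ t in (0 : ℝ)..1, ‖u t‖) < c := by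
  by_contra! H
  exact absurd (le_ccEDist H) (not_le.2 h)

theorem isHorizontal_const (p : M) : IsHorizontal X (fun _ ↦ p) (fun _ ↦ 0) where
  continuousOn := continuousOn_const
  integrableOn := integrableOn_zero
  integral_eq f _ t _ := by simp

theorem ccEDist_self (p : M) : ccEDist X p p = 0 := by
  have := (isHorizontal_const (X := X) p).ccEDist_le
  simpa using this

theorem IsHorizontal.intervalIntegrable_control {γ : ℝ → M} {u : ℝ → EuclideanSpace ℝ ι}
    (h : IsHorizontal X γ u) : IntervalIntegrable u volume 0 1 :=
  (intervalIntegrable_iff_integrableOn_Icc_of_le zero_le_one).2 h.integrableOn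

theorem IsHorizontal.intervalIntegrable_apply {γ : ℝ → M} {u : ℝ → EuclideanSpace ℝ ι}
    (h : IsHorizontal X γ u) (i : ι) : IntervalIntegrable (fun t ↦ u t i) volume 0 1 :=
  (intervalIntegrable_iff_integrableOn_Icc_of_le zero_le_one).2
    ((EuclideanSpace.proj (𝕜 := ℝ) i).integrable_comp h.integrableOn)

theorem IsHorizontal.intervalIntegrable {γ : ℝ → M} {u : ℝ → EuclideanSpace ℝ ι}
    (h : IsHorizontal X γ u) {f : M → ℝ}
    (hf : ∀ i, Continuous fun p ↦ dirDeriv f p (X i p)) :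
    IntervalIntegrable (fun s ↦ ∑ i, u s i * dirDeriv f (γ s) (X i (γ s))) volume 0 1 := by
  have : IntervalIntegrable (∑ i, fun s ↦ u s i * dirDeriv f (γ s) (X i (γ s))) volume 0 1 := by
    refine IntervalIntegrable.sum _ fun i _ ↦ (h.intervalIntegrable_apply i).mul_continuousOn ?_
    rw [uIcc_of_le zero_le_one]
    exact (hf i).comp_continuousOn h.continuousOn
  convert this using 1
  ext s
  simp

/-- Continuity of the derivatives along the frame, the hypothesis `hX`, makes the integrands in the
definition of a horizontal curve integrable, so that their integrals can be split. -/
theorem IsHorizontal.reverse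
    (hX : ∀ f : M → ℝ, ContMDiff (𝓡 n) 𝓘(ℝ, ℝ) ∞ f → ∀ i, Continuous fun p ↦ dirDeriv f p (X i p))
    {γ : ℝ → M} {u : ℝ → EuclideanSpace ℝ ι} (h : IsHorizontal X γ u) :
    IsHorizontal X (fun t ↦ γ (1 - t)) (fun t ↦ -u (1 - t)) where
  continuousOn := h.continuousOn.comp (by fun_prop) fun t ht ↦ by
    constructor <;> linarith [ht.1, ht.2]
  integrableOn := by
    rw [← intervalIntegrable_iff_integrableOn_Icc_of_le zero_le_one]
    have := (h.intervalIntegrable_control.comp_sub_left 1).neg.symm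
    rw [sub_zero, sub_self] at this
    exact this
  integral_eq f hf t ht := by
    have hI := h.intervalIntegrable (hX f hf)
    have h1 := h.integral_eq f hf 1 (by simp)
    have h2 := h.integral_eq f hf (1 - t) ⟨by linarith [ht.2], by linarith [ht.1]⟩
    have h3 := intervalIntegral.integral_comp_sub_left (a := 0) (b := t)
      (fun s ↦ ∑ i, u s i * dirDeriv f (γ s) (X i (γ s))) 1
    rw [sub_zero, ← intervalIntegral.integral_interval_sub_left (a := 0) hI
      (hI.mono_set (uIcc_subset_uIcc (by simp)
        (by rw [mem_uIcc]; left; constructor <;> linarith [ht.1, ht.2]))), ← h1, ← h2] at h3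
    simp only [PiLp.neg_apply, neg_mul, Finset.sum_neg_distrib, intervalIntegral.integral_neg,
      h3, sub_zero]
    ring

theorem ccEDist_comm
    (hX : ∀ f : M → ℝ, ContMDiff (𝓡 n) 𝓘(ℝ, ℝ) ∞ f → ∀ i, Continuous fun p ↦ dirDeriv f p (X i p))
    (p q : M) : ccEDist X p q = ccEDist X q p := by
  suffices H : ∀ p q, ccEDist X p q ≤ ccEDist X q p from le_antisymm (H p q) (H q p)
  rintro p q
  refine le_ccEDist fun γ u h h0 h1 ↦ ?_
  have := (h.reverse hX).ccEDist_le
  simp only [sub_zero, sub_self, h0, h1, norm_neg] at this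
  have h3 := intervalIntegral.integral_comp_sub_left (a := 0) (b := 1) (fun s ↦ ‖u s‖) 1
  rw [sub_zero, sub_self] at h3
  rwa [h3] at this

theorem IsHorizontal.concat
    (hX : ∀ f : M → ℝ, ContMDiff (𝓡 n) 𝓘(ℝ, ℝ) ∞ f → ∀ i, Continuous fun p ↦ dirDeriv f p (X i p))
    {γ₁ γ₂ : ℝ → M} {u₁ u₂ : ℝ → EuclideanSpace ℝ ι} (h₁ : IsHorizontal X γ₁ u₁)
    (h₂ : IsHorizontal X γ₂ u₂) (h : γ₁ 1 = γ₂ 0) :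
    IsHorizontal X (concat γ₁ γ₂) (fun t ↦ (2 : ℝ) • concat u₁ u₂ t) where
  continuousOn := by
    have hl : ContinuousOn (SubRiem.concat γ₁ γ₂) (Icc 0 (1 / 2)) := by
      refine (h₁.continuousOn.comp (f := fun t ↦ 2 * t) (by fun_prop) fun t ht ↦ ?_).congr
        fun t ht ↦ ?_
      · constructor <;> linarith [ht.1, ht.2]
      · exact concat_of_le _ _ ht.2
    have hr : ContinuousOn (SubRiem.concat γ₁ γ₂) (Icc (1 / 2) 1) := by
      refine (h₂.continuousOn.comp (f := fun t ↦ 2 * t - 1) (by fun_prop) fun t ht ↦ ?_).congr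
        fun t ht ↦ ?_
      · constructor <;> linarith [ht.1, ht.2]
      · rcases ht.1.eq_or_lt with h' | h'
        · subst h'
          simp [SubRiem.concat, h]
        · exact concat_of_gt _ _ h'
    rw [← Icc_union_Icc_eq_Icc (b := (1 / 2 : ℝ)) (by norm_num) (by norm_num)]
    exact hl.union_of_isClosed hr isClosed_Icc isClosed_Icc
  integrableOn := (intervalIntegrable_iff_integrableOn_Icc_of_le zero_le_one).1
    (intervalIntegrable_two_smul_concat h₁.intervalIntegrable_control h₂.intervalIntegrable_control)
  integral_eq f hf t ht := by
    have e : ∀ s, ∑ i, ((2 : ℝ) • SubRiem.concat u₁ u₂ s) i *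
        dirDeriv f (SubRiem.concat γ₁ γ₂ s) (X i (SubRiem.concat γ₁ γ₂ s)) =
        (2 : ℝ) • SubRiem.concat (fun s ↦ ∑ i, u₁ s i * dirDeriv f (γ₁ s) (X i (γ₁ s)))
          (fun s ↦ ∑ i, u₂ s i * dirDeriv f (γ₂ s) (X i (γ₂ s))) s := by
      intro s
      by_cases hs : s ≤ 1 / 2
      · rw [concat_of_le γ₁ γ₂ hs, concat_of_le u₁ u₂ hs, concat_of_le _ _ hs]
        simp only [PiLp.smul_apply, smul_eq_mul, Finset.mul_sum, mul_assoc]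
      · rw [not_le] at hs
        rw [concat_of_gt γ₁ γ₂ hs, concat_of_gt u₁ u₂ hs, concat_of_gt _ _ hs]
        simp only [PiLp.smul_apply, smul_eq_mul, Finset.mul_sum, mul_assoc]
    simp only [e]
    have h0 : SubRiem.concat γ₁ γ₂ 0 = γ₁ 0 := by simp [SubRiem.concat]
    rw [h0]
    rcases le_or_gt t (1 / 2) with h' | h'
    · rw [integral_two_smul_concat_of_le ht.1 h',
        ← h₁.integral_eq f hf _ ⟨by linarith [ht.1], by linarith⟩]
      rw [concat_of_le _ _ h']
    · rw [integral_two_smul_concat_of_ge (h₁.intervalIntegrable (hX f hf))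
        (h₂.intervalIntegrable (hX f hf)) h'.le ht.2,
        ← h₁.integral_eq f hf _ (by simp),
        ← h₂.integral_eq f hf _ ⟨by linarith [ht.1], by linarith [ht.2]⟩, h]
      rw [concat_of_gt _ _ h']
      ring

theorem ccEDist_triangle
    (hX : ∀ f : M → ℝ, ContMDiff (𝓡 n) 𝓘(ℝ, ℝ) ∞ f → ∀ i, Continuous fun p ↦ dirDeriv f p (X i p))
    (p q r : M) : ccEDist X p r ≤ ccEDist X p q + ccEDist X q r := by
  refine ENNReal.le_of_forall_pos_le_add ?_
  intro ε hε hlt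
  obtain ⟨hpq, hqr⟩ := ENNReal.add_lt_top.1 hlt
  have hε' : ((ε / 2 : ℝ≥0) : ℝ≥0∞) ≠ 0 := by simpa using hε.ne'
  obtain ⟨γ₁, u₁, H₁, a₁, b₁, l₁⟩ :=
    exists_isHorizontal_of_ccEDist_lt (ENNReal.lt_add_right hpq.ne hε')
  obtain ⟨γ₂, u₂, H₂, a₂, b₂, l₂⟩ :=
    exists_isHorizontal_of_ccEDist_lt (ENNReal.lt_add_right hqr.ne hε')
  have H := (H₁.concat hX H₂ (b₁.trans a₂.symm)).ccEDist_le
  have e : ∀ t, ‖(2 : ℝ) • concat u₁ u₂ t‖ =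
      (2 : ℝ) • concat (fun t ↦ ‖u₁ t‖) (fun t ↦ ‖u₂ t‖) t := by
    intro t
    by_cases ht : t ≤ 1 / 2 <;> simp only [concat, ht, norm_smul, if_true, if_false] <;> simp
  have h0 : concat γ₁ γ₂ 0 = p := by simp [concat, a₁]
  have h1 : concat γ₁ γ₂ 1 = r := by
    simp only [concat]; norm_num; exact b₂
  simp only [e] at H
  rw [h0, h1, integral_two_smul_concat_of_ge H₁.intervalIntegrable_control.norm
    H₂.intervalIntegrable_control.norm (by norm_num) le_rfl] at H
  norm_num at H
  refine H.trans (ENNReal.ofReal_add_le.trans ((add_le_add l₁.le l₂.le).trans ?_))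
  rw [add_add_add_comm, ← ENNReal.coe_add, add_halves]

end Distance

/-! ### Estimates of the Carnot–Carathéodory distance of the Grushin plane -/

theorem dirDeriv_grushinFrame_zero (f : EuclideanSpace ℝ (Fin 2) → ℝ)
    (p : EuclideanSpace ℝ (Fin 2)) :
    dirDeriv f p (grushinFrame 0 p) = fderiv ℝ f p !₂[1, 0] :=
  congrArg (fun L : EuclideanSpace ℝ (Fin 2) →L[ℝ] ℝ ↦ L !₂[1, 0]) mfderiv_eq_fderiv

theorem dirDeriv_grushinFrame_one (f : EuclideanSpace ℝ (Fin 2) → ℝ)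
    (p : EuclideanSpace ℝ (Fin 2)) :
    dirDeriv f p (grushinFrame 1 p) = fderiv ℝ f p !₂[0, p 0] :=
  congrArg (fun L : EuclideanSpace ℝ (Fin 2) →L[ℝ] ℝ ↦ L !₂[0, p 0]) mfderiv_eq_fderiv

theorem contDiff_grushinFrame (i : Fin 2) :
    ContDiff ℝ ∞ (fun p ↦ (grushinFrame i p : EuclideanSpace ℝ (Fin 2))) := by
  fin_cases i
  · exact contDiff_const
  · refine (contDiff_euclidean (𝕜 := ℝ)).2 fun j ↦ ?_
    fin_cases j
    · exact contDiff_const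
    · exact (contDiff_euclidean (𝕜 := ℝ)).1 contDiff_id 0

theorem continuous_dirDeriv_grushinFrame (f : EuclideanSpace ℝ (Fin 2) → ℝ)
    (hf : ContMDiff (𝓡 2) 𝓘(ℝ, ℝ) ∞ f) (i : Fin 2) :
    Continuous fun p ↦ dirDeriv f p (grushinFrame i p) := by
  have hf' := (contMDiff_iff_contDiff.1 hf).continuous_fderiv (by simp)
  have hi := hf'.clm_apply (contDiff_grushinFrame i).continuous
  fin_cases i
  · exact hi.congr fun p ↦ (dirDeriv_grushinFrame_zero f p).symm
  · exact hi.congr fun p ↦ (dirDeriv_grushinFrame_one f p).symm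

theorem isHorizontal_affine {p w c : EuclideanSpace ℝ (Fin 2)}
    (h : ∀ t : ℝ, c 0 • !₂[1, 0] + c 1 • !₂[0, (p + t • w) 0] = w) :
    IsHorizontal grushinFrame (fun t ↦ p + t • w) (fun _ ↦ c) where
  continuousOn := by fun_prop
  integrableOn := by simp
  integral_eq f hf t _ := by
    have hf' := contMDiff_iff_contDiff.1 hf
    have e : ∀ s : ℝ, ∑ i, c i * dirDeriv f (p + s • w) (grushinFrame i (p + s • w)) =
        fderiv ℝ f (p + s • w) w := by
      intro s
      rw [Fin.sum_univ_two, dirDeriv_grushinFrame_zero, dirDeriv_grushinFrame_one,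
        ← smul_eq_mul, ← smul_eq_mul, ← map_smul, ← map_smul, ← map_add, h s]
    simp only [e]
    rw [intervalIntegral.integral_eq_sub_of_hasDerivAt (f := fun s : ℝ ↦ f (p + s • w))]
    · intro s _
      have h1 : HasDerivAt (fun s : ℝ ↦ p + s • w) w s := by
        simpa using ((hasDerivAt_id s).smul_const w).const_add p
      exact ((hf'.differentiable (by simp) _).hasFDerivAt).comp_hasDerivAt s h1
    · refine Continuous.intervalIntegrable ?_ _ _
      exact ((hf'.continuous_fderiv (by simp)).comp (by fun_prop)).clm_apply continuous_const

theorem ccEDist_affine_le {p w c : EuclideanSpace ℝ (Fin 2)}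
    (h : ∀ t : ℝ, c 0 • !₂[1, 0] + c 1 • !₂[0, (p + t • w) 0] = w) :
    ccEDist grushinFrame p (p + w) ≤ ENNReal.ofReal ‖c‖ := by
  simpa using (isHorizontal_affine h).ccEDist_le

theorem ccEDist_grushin_horizontal_le (x x' y : ℝ) :
    ccEDist grushinFrame !₂[x, y] !₂[x', y] ≤ ENNReal.ofReal |x' - x| := by
  have := ccEDist_affine_le (p := !₂[x, y]) (w := !₂[x' - x, 0]) (c := !₂[x' - x, 0]) (by
    intro t
    ext i
    fin_cases i <;> simp)
  convert this using 2
  · ext i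
    fin_cases i <;> simp
  · simp [EuclideanSpace.norm_eq, Real.sqrt_sq_eq_abs]

theorem ccEDist_grushin_vertical_le {x : ℝ} (hx : x ≠ 0) (y y' : ℝ) :
    ccEDist grushinFrame !₂[x, y] !₂[x, y'] ≤ ENNReal.ofReal (|y' - y| / |x|) := by
  have := ccEDist_affine_le (p := !₂[x, y]) (w := !₂[0, y' - y]) (c := !₂[0, (y' - y) / x]) (by
    intro t
    ext i
    fin_cases i <;> simp [hx])
  convert this using 2
  · ext i
    fin_cases i <;> simp
  · simp [EuclideanSpace.norm_eq, Real.sqrt_sq_eq_abs, abs_div]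

theorem ccEDist_grushin_triangle (p q r : EuclideanSpace ℝ (Fin 2)) :
    ccEDist grushinFrame p r ≤ ccEDist grushinFrame p q + ccEDist grushinFrame q r :=
  ccEDist_triangle continuous_dirDeriv_grushinFrame p q r

/-- Off the axis the distance is locally bounded by the Euclidean one: a vertical segment followed by
a horizontal one joins the two points. -/
theorem ccEDist_grushin_le_of_ne {x : ℝ} (hx : x ≠ 0) (y x' y' : ℝ) :
    ccEDist grushinFrame !₂[x, y] !₂[x', y'] ≤
      ENNReal.ofReal (|x' - x| + |y' - y| / |x|) := by
  rw [ENNReal.ofReal_add (by positivity) (by positivity), add_comm]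
  exact (ccEDist_grushin_triangle _ !₂[x, y'] _).trans
    (add_le_add (ccEDist_grushin_vertical_le hx y y') (ccEDist_grushin_horizontal_le x x' y'))

/-- Everywhere, the vertical displacement costs at most a multiple of its square root: move away from
the axis by that square root, then vertically, then back. -/
theorem ccEDist_grushin_le (x y x' y' : ℝ) :
    ccEDist grushinFrame !₂[x, y] !₂[x', y'] ≤
      ENNReal.ofReal (|x' - x| + 3 * √|y' - y|) := by
  obtain rfl | hy := eq_or_ne y y'
  · simpa using ccEDist_grushin_horizontal_le x x' y
  have hr : 0 < √|y' - y| := Real.sqrt_pos.2 (abs_pos.2 (sub_ne_zero.2 hy.symm))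
  have hsq : |y' - y| = √|y' - y| * √|y' - y| := (Real.mul_self_sqrt (abs_nonneg _)).symm
  generalize √|y' - y| = r at hr hsq ⊢
  obtain ⟨z, hz, hzr⟩ : ∃ z : ℝ, |z - x| = r ∧ r ≤ |z| := by
    rcases le_total 0 x with h | h
    · refine ⟨x + r, ?_, ?_⟩
      · rw [add_sub_cancel_left, abs_of_pos hr]
      · rw [abs_of_pos (by linarith)]; linarith
    · refine ⟨x - r, ?_, ?_⟩
      · rw [sub_sub_cancel_left, abs_neg, abs_of_pos hr]
      · rw [abs_of_nonpos (by linarith)]; linarith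
  have hz0 : z ≠ 0 := abs_pos.1 (hr.trans_le hzr)
  refine (ccEDist_grushin_triangle _ !₂[z, y] _).trans ((add_le_add
    (ccEDist_grushin_horizontal_le x z y) (ccEDist_grushin_le_of_ne hz0 y x' y')).trans ?_)
  rw [← ENNReal.ofReal_add (by positivity) (by positivity)]
  refine ENNReal.ofReal_le_ofReal ?_
  have h1 : |x' - z| ≤ |x' - x| + |z - x| := by
    rw [abs_sub_comm z x]; exact abs_sub_le _ _ _
  have h2 : |y' - y| / |z| ≤ r := by
    rw [div_le_iff₀ (abs_pos.2 hz0)]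
    calc |y' - y| = r * r := hsq
      _ ≤ _ := mul_le_mul_of_nonneg_left hzr hr.le
  linarith

section LowerBounds

variable {γ : ℝ → EuclideanSpace ℝ (Fin 2)} {u : ℝ → EuclideanSpace ℝ (Fin 2)}

theorem IsHorizontal.grushin_sub_zero (h : IsHorizontal grushinFrame γ u) {t : ℝ}
    (ht : t ∈ Icc (0 : ℝ) 1) : γ t 0 - γ 0 0 = ∫ s in (0 : ℝ)..t, u s 0 := by
  have := h.integral_eq (fun p ↦ p 0)
    ((EuclideanSpace.proj (𝕜 := ℝ) (0 : Fin 2)).contDiff.contMDiff) t ht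
  rw [this]
  refine intervalIntegral.integral_congr fun s _ ↦ ?_
  have e : ∀ p, fderiv ℝ (fun p : EuclideanSpace ℝ (Fin 2) ↦ p 0) p =
      EuclideanSpace.proj 0 := fun p ↦ (EuclideanSpace.proj (𝕜 := ℝ) (0 : Fin 2)).fderiv
  simp only [Fin.sum_univ_two, dirDeriv_grushinFrame_zero, dirDeriv_grushinFrame_one, e]
  simp

theorem IsHorizontal.grushin_sub_one (h : IsHorizontal grushinFrame γ u) {t : ℝ}
    (ht : t ∈ Icc (0 : ℝ) 1) : γ t 1 - γ 0 1 = ∫ s in (0 : ℝ)..t, u s 1 * γ s 0 := by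
  have := h.integral_eq (fun p ↦ p 1)
    ((EuclideanSpace.proj (𝕜 := ℝ) (1 : Fin 2)).contDiff.contMDiff) t ht
  rw [this]
  refine intervalIntegral.integral_congr fun s _ ↦ ?_
  have e : ∀ p, fderiv ℝ (fun p : EuclideanSpace ℝ (Fin 2) ↦ p 1) p =
      EuclideanSpace.proj 1 := fun p ↦ (EuclideanSpace.proj (𝕜 := ℝ) (1 : Fin 2)).fderiv
  simp only [Fin.sum_univ_two, dirDeriv_grushinFrame_zero, dirDeriv_grushinFrame_one, e]
  simp

theorem IsHorizontal.abs_grushin_sub_zero_le (h : IsHorizontal grushinFrame γ u) {t : ℝ}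
    (ht : t ∈ Icc (0 : ℝ) 1) : |γ t 0 - γ 0 0| ≤ ∫ s in (0 : ℝ)..1, ‖u s‖ := by
  have hI := h.intervalIntegrable_control.norm
  have hsub : uIcc 0 t ⊆ uIcc (0 : ℝ) 1 := by
    rw [uIcc_of_le ht.1, uIcc_of_le zero_le_one]; exact Icc_subset_Icc_right ht.2
  rw [h.grushin_sub_zero ht]
  calc |∫ s in (0 : ℝ)..t, u s 0| ≤ ∫ s in (0 : ℝ)..t, ‖u s‖ := by
        rw [← Real.norm_eq_abs]
        exact intervalIntegral.norm_integral_le_of_norm_le ht.1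
          (ae_of_all _ fun s _ ↦ PiLp.norm_apply_le (u s) 0) (hI.mono_set hsub)
    _ ≤ _ := intervalIntegral.integral_mono_interval le_rfl ht.1 ht.2
        (ae_of_all _ fun s ↦ norm_nonneg _) hI

theorem IsHorizontal.abs_grushin_sub_one_le (h : IsHorizontal grushinFrame γ u) :
    |γ 1 1 - γ 0 1| ≤ (∫ s in (0 : ℝ)..1, ‖u s‖) * (|γ 0 0| + ∫ s in (0 : ℝ)..1, ‖u s‖) := by
  have hI := h.intervalIntegrable_control.norm
  rw [h.grushin_sub_one (by simp), ← Real.norm_eq_abs, ← intervalIntegral.integral_mul_const]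
  refine intervalIntegral.norm_integral_le_of_norm_le zero_le_one
    (ae_of_all _ fun s hs ↦ ?_) (hI.mul_const _)
  rw [norm_mul]
  refine mul_le_mul (PiLp.norm_apply_le (u s) 1) ?_ (norm_nonneg _) (norm_nonneg _)
  have h1 := h.abs_grushin_sub_zero_le ⟨hs.1.le, hs.2⟩
  have h2 := abs_sub_abs_le_abs_sub (γ s 0) (γ 0 0)
  rw [Real.norm_eq_abs]
  linarith

end LowerBounds

theorem abs_sub_le_of_ccEDist_grushin_lt {p q : EuclideanSpace ℝ (Fin 2)} {r : ℝ}
    (h : ccEDist grushinFrame p q < ENNReal.ofReal r) :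
    |q 0 - p 0| ≤ r ∧ |q 1 - p 1| ≤ r * (|p 0| + r) := by
  obtain ⟨γ, u, H, rfl, rfl, hr⟩ := exists_isHorizontal_of_ccEDist_lt h
  have h0 : 0 ≤ ∫ s in (0 : ℝ)..1, ‖u s‖ :=
    intervalIntegral.integral_nonneg zero_le_one fun _ _ ↦ norm_nonneg _
  have hr' : ∫ s in (0 : ℝ)..1, ‖u s‖ ≤ r := ((ENNReal.ofReal_lt_ofReal_iff').1 hr).1.le
  refine ⟨(H.abs_grushin_sub_zero_le (by simp)).trans hr', H.abs_grushin_sub_one_le.trans ?_⟩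
  gcongr
  exact h0.trans hr'

/-! ### The Grushin plane as a metric space and as a sub-Riemannian manifold -/

theorem eq_toLp_plane (p : EuclideanSpace ℝ (Fin 2)) : p = !₂[p 0, p 1] := by
  ext i
  fin_cases i <;> rfl

theorem ccEDist_grushin_le_coord (p q : EuclideanSpace ℝ (Fin 2)) :
    ccEDist grushinFrame p q ≤ ENNReal.ofReal (|q 0 - p 0| + 3 * √|q 1 - p 1|) := by
  have := ccEDist_grushin_le (p 0) (p 1) (q 0) (q 1)
  rwa [← eq_toLp_plane, ← eq_toLp_plane] at this

theorem ccEDist_grushin_ne_top (p q : EuclideanSpace ℝ (Fin 2)) :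
    ccEDist grushinFrame p q ≠ ⊤ :=
  ((ccEDist_grushin_le_coord p q).trans_lt ENNReal.ofReal_lt_top).ne

/-- From a point of the axis, the vertical displacement is at most the square of the distance. -/
theorem abs_sub_le_toReal_ccEDist (p q : EuclideanSpace ℝ (Fin 2)) :
    |q 0 - p 0| ≤ (ccEDist grushinFrame p q).toReal ∧
      |q 1 - p 1| ≤ (ccEDist grushinFrame p q).toReal *
        (|p 0| + (ccEDist grushinFrame p q).toReal) := by
  set d := (ccEDist grushinFrame p q).toReal with hd
  have H : ∀ r ∈ Ioi d, |q 0 - p 0| ≤ r ∧ |q 1 - p 1| ≤ r * (|p 0| + r) := fun r hr ↦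
    abs_sub_le_of_ccEDist_grushin_lt
      ((ENNReal.lt_ofReal_iff_toReal_lt (ccEDist_grushin_ne_top p q)).2 hr)
  have c : Tendsto (fun r : ℝ ↦ r * (|p 0| + r)) (𝓝[>] d) (𝓝 (d * (|p 0| + d))) := by
    have : Continuous fun r : ℝ ↦ r * (|p 0| + r) := by fun_prop
    exact (this.tendsto d).mono_left nhdsWithin_le_nhds
  exact ⟨le_of_forall_gt_imp_ge_of_dense fun r hr ↦ (H r hr).1,
    ge_of_tendsto c (by filter_upwards [self_mem_nhdsWithin] with r hr using (H r hr).2)⟩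

theorem dist_le_abs_add_abs (p q : EuclideanSpace ℝ (Fin 2)) :
    dist p q ≤ |q 0 - p 0| + |q 1 - p 1| := by
  rw [dist_comm, EuclideanSpace.dist_eq, Fin.sum_univ_two, Real.dist_eq, Real.dist_eq]
  refine Real.sqrt_le_iff.2 ⟨by positivity, ?_⟩
  nlinarith [abs_nonneg (q 0 - p 0), abs_nonneg (q 1 - p 1)]

/-- The Carnot–Carathéodory distance of the Grushin frame, as a metric on the plane with the metric
topology (which is equal, but not by definition, to the Euclidean one). -/
noncomputable abbrev grushinMetric : MetricSpace (EuclideanSpace ℝ (Fin 2)) :=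
  letI : EMetricSpace (EuclideanSpace ℝ (Fin 2)) :=
    { edist := ccEDist grushinFrame
      edist_self := ccEDist_self
      edist_comm := ccEDist_comm continuous_dirDeriv_grushinFrame
      edist_triangle := ccEDist_grushin_triangle
      eq_of_edist_eq_zero := fun {p q} h ↦ by
        obtain ⟨h0, h1⟩ := abs_sub_le_toReal_ccEDist p q
        have h' : ccEDist grushinFrame p q = 0 := h
        rw [h', ENNReal.toReal_zero] at h0 h1
        rw [zero_mul] at h1
        have := dist_le_abs_add_abs p q
        exact dist_le_zero.1 (by linarith) }
  EMetricSpace.toMetricSpace ccEDist_grushin_ne_top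

theorem euclidean_topology_eq_grushinMetric :
    (inferInstance : TopologicalSpace (EuclideanSpace ℝ (Fin 2))) =
      grushinMetric.toPseudoMetricSpace.toUniformSpace.toTopologicalSpace := by
  refine TopologicalSpace.ext_nhds fun p ↦ le_antisymm ?_ ?_
  · refine (@Metric.nhds_basis_eball _
      grushinMetric.toPseudoMetricSpace.toPseudoEMetricSpace p).ge_iff.2 fun ε hε ↦ ?_
    have c : Tendsto (fun q : EuclideanSpace ℝ (Fin 2) ↦
        ENNReal.ofReal (|p 0 - q 0| + 3 * √|p 1 - q 1|)) (𝓝 p) (𝓝 0) := by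
      have : Continuous fun q : EuclideanSpace ℝ (Fin 2) ↦
        ENNReal.ofReal (|p 0 - q 0| + 3 * √|p 1 - q 1|) :=
        ENNReal.continuous_ofReal.comp (by fun_prop)
      simpa using this.tendsto p
    filter_upwards [c.eventually (gt_mem_nhds hε)] with q hq
    exact (ccEDist_grushin_le_coord q p).trans_lt hq
  · refine Metric.nhds_basis_ball.ge_iff.2 fun ε hε ↦ ?_
    refine (@Metric.nhds_basis_eball _
      grushinMetric.toPseudoMetricSpace.toPseudoEMetricSpace p).mem_iff.2 ?_
    have hp := abs_nonneg (p 0)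
    have hr : 0 < min 1 (ε / (3 + |p 0|)) := by positivity
    refine ⟨ENNReal.ofReal (min 1 (ε / (3 + |p 0|))), ENNReal.ofReal_pos.2 hr, fun q hq ↦ ?_⟩
    have hq' : ccEDist grushinFrame p q < ENNReal.ofReal (min 1 (ε / (3 + |p 0|))) := by
      rw [ccEDist_comm continuous_dirDeriv_grushinFrame]
      exact hq
    obtain ⟨h0, h1⟩ := abs_sub_le_of_ccEDist_grushin_lt hq'
    have hr1 := min_le_left 1 (ε / (3 + |p 0|))
    have hr2 := min_le_right 1 (ε / (3 + |p 0|))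
    rw [le_div_iff₀ (by positivity)] at hr2
    have := dist_le_abs_add_abs p q
    rw [Metric.mem_ball, dist_comm]
    nlinarith

/-- The plane with the Carnot–Carathéodory distance of the Grushin frame. It is a type synonym, so
that the Euclidean distance does not interfere. -/
def GrushinPlane : Type := EuclideanSpace ℝ (Fin 2)

namespace GrushinPlane

/-- The underlying point of the Euclidean plane. -/
def coord (p : GrushinPlane) : EuclideanSpace ℝ (Fin 2) := p

/-- The point of the Grushin plane with the given coordinates. -/
def ofCoord (p : EuclideanSpace ℝ (Fin 2)) : GrushinPlane := p

theorem ofCoord_coord (p : GrushinPlane) : ofCoord p.coord = p := rfl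

/-- The topology of this metric space is definitionally the Euclidean one, so that the Grushin plane
has the manifold structure of the Euclidean plane. -/
noncomputable instance : MetricSpace GrushinPlane :=
  grushinMetric.replaceTopology euclidean_topology_eq_grushinMetric

instance : ChartedSpace (EuclideanSpace ℝ (Fin 2)) GrushinPlane :=
  chartedSpaceSelf (EuclideanSpace ℝ (Fin 2))

/-- The vector fields `∂/∂x` and `x ∂/∂y`. -/
noncomputable def frame (i : Fin 2) (p : GrushinPlane) : TangentSpace (𝓡 2) p :=
  grushinFrame i p.coord

theorem edist_eq (p q : GrushinPlane) : edist p q = ccEDist grushinFrame p.coord q.coord := rfl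

theorem dist_eq (p q : GrushinPlane) :
    dist p q = (ccEDist grushinFrame p.coord q.coord).toReal := by
  rw [dist_edist, edist_eq]

end GrushinPlane

theorem contMDiff_grushinFrame (i : Fin 2) :
    ContMDiff (𝓡 2) (𝓡 2).tangent ∞ (fun p : EuclideanSpace ℝ (Fin 2) ↦
      (⟨p, grushinFrame i p⟩ : TangentBundle (𝓡 2) (EuclideanSpace ℝ (Fin 2)))) :=
  contMDiff_vectorSpace_iff_contDiff.2 (contDiff_grushinFrame i)

theorem mlieBracket_grushinFrame (p : EuclideanSpace ℝ (Fin 2)) :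
    VectorField.mlieBracket (𝓡 2) (grushinFrame 0) (grushinFrame 1) p = !₂[0, 1] := by
  have e : VectorField.mlieBracket (𝓡 2) (grushinFrame 0) (grushinFrame 1) =
      VectorField.lieBracket ℝ (E := EuclideanSpace ℝ (Fin 2))
        (fun _ ↦ !₂[1, 0]) (fun p ↦ !₂[0, p 0]) :=
    VectorField.mlieBracketWithin_univ.symm.trans
      (VectorField.mlieBracketWithin_eq_lieBracketWithin.trans VectorField.lieBracketWithin_univ)
  -- The second vector field is linear, hence equal to its derivative.
  let L : EuclideanSpace ℝ (Fin 2) →L[ℝ] EuclideanSpace ℝ (Fin 2) :=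
    (EuclideanSpace.proj (𝕜 := ℝ) (0 : Fin 2)).smulRight !₂[0, 1]
  have hL : (fun p : EuclideanSpace ℝ (Fin 2) ↦ !₂[0, p 0]) = L := by
    ext p i
    fin_cases i <;> simp [L]
  rw [e, VectorField.lieBracket_eq, hL]
  simp [L]
  rfl

theorem submodule_eq_top_of_mem {S : Submodule ℝ (EuclideanSpace ℝ (Fin 2))}
    (h₀ : !₂[1, 0] ∈ S) (h₁ : !₂[0, 1] ∈ S) : S = ⊤ := by
  refine eq_top_iff.2 fun v _ ↦ ?_
  have e : v = v 0 • !₂[1, 0] + v 1 • !₂[0, 1] := by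
    ext i
    fin_cases i <;> simp
  rw [e]
  exact S.add_mem (S.smul_mem _ h₀) (S.smul_mem _ h₁)

theorem bracketGenerating_grushinFrame : BracketGenerating (n := 2) grushinFrame := by
  intro p
  have h0 := Submodule.subset_span (R := ℝ) (show grushinFrame 0 p ∈
    {v : TangentSpace (𝓡 2) p | ∃ V, IsIteratedBracket (n := 2) grushinFrame V ∧ V p = v} from
      ⟨_, .base 0, rfl⟩)
  have h1 := Submodule.subset_span (R := ℝ) (show
    VectorField.mlieBracket (𝓡 2) (grushinFrame 0) (grushinFrame 1) p ∈
    {v : TangentSpace (𝓡 2) p | ∃ V, IsIteratedBracket (n := 2) grushinFrame V ∧ V p = v} from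
      ⟨_, .bracket _ _ (.base 0) (.base 1), rfl⟩)
  rw [mlieBracket_grushinFrame] at h1
  exact submodule_eq_top_of_mem h0 h1

theorem isSubRiemannianManifold_grushinPlane : IsSubRiemannianManifold GrushinPlane.frame where
  connected := (inferInstance : ConnectedSpace (EuclideanSpace ℝ (Fin 2)))
  isManifold := (inferInstance : IsManifold (𝓡 2) ∞ (EuclideanSpace ℝ (Fin 2)))
  smooth := contMDiff_grushinFrame
  bracketGenerating := bracketGenerating_grushinFrame
  edist_eq := GrushinPlane.edist_eq

theorem isGrushin_grushinPlane : IsGrushin GrushinPlane.frame := by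
  refine ⟨Diffeomorph.refl (𝓡 2) (EuclideanSpace ℝ (Fin 2)) ∞, fun i p ↦ ?_⟩
  exact congrArg (fun L : EuclideanSpace ℝ (Fin 2) →L[ℝ] EuclideanSpace ℝ (Fin 2) ↦
    L (grushinFrame i p)) (mfderiv_id (I := 𝓡 2) (x := (p : EuclideanSpace ℝ (Fin 2))))

/-! ### A `1/2`-Hölder curve filling a triangle -/

theorem dist_sq_eq_plane (p q : EuclideanSpace ℝ (Fin 2)) :
    dist p q ^ 2 = (p 0 - q 0) ^ 2 + (p 1 - q 1) ^ 2 := by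
  rw [EuclideanSpace.dist_eq, Real.sq_sqrt (by positivity), Fin.sum_univ_two, Real.dist_eq,
    Real.dist_eq, sq_abs, sq_abs]

theorem dist_sq_le_two_mul (p q r : EuclideanSpace ℝ (Fin 2)) :
    dist p r ^ 2 ≤ 2 * (dist p q ^ 2 + dist q r ^ 2) := by
  have := pow_le_pow_left₀ dist_nonneg (dist_triangle p q r) 2
  linarith [sq_nonneg (dist p q - dist q r), add_sq (dist p q) (dist q r),
    sub_sq (dist p q) (dist q r)]

/-- The isosceles right triangle with hypotenuse from `(0, 0)` to `(1, 0)` and apex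
`(1 / 2, 1 / 2)`. -/
def polyaTriangle : Set (EuclideanSpace ℝ (Fin 2)) :=
  {z | 0 ≤ z 1 ∧ z 1 ≤ z 0 ∧ z 0 + z 1 ≤ 1}

/-- The similarity of ratio `1 / √2` from the triangle onto its left half, taking the ends of the
hypotenuse to `(0, 0)` and the apex. -/
noncomputable def polyaLeft (z : EuclideanSpace ℝ (Fin 2)) : EuclideanSpace ℝ (Fin 2) :=
  !₂[(z 0 + z 1) / 2, (z 0 - z 1) / 2]

/-- The similarity of ratio `1 / √2` from the triangle onto its right half, taking the ends of the
hypotenuse to the apex and `(1, 0)`. -/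
noncomputable def polyaRight (z : EuclideanSpace ℝ (Fin 2)) : EuclideanSpace ℝ (Fin 2) :=
  !₂[(1 + z 0 - z 1) / 2, (1 - z 0 - z 1) / 2]

theorem dist_polyaLeft_sq (z w : EuclideanSpace ℝ (Fin 2)) :
    dist (polyaLeft z) (polyaLeft w) ^ 2 = dist z w ^ 2 / 2 := by
  simp only [dist_sq_eq_plane, polyaLeft, Matrix.cons_val_zero,
    Matrix.cons_val_one]
  ring

theorem dist_polyaRight_sq (z w : EuclideanSpace ℝ (Fin 2)) :
    dist (polyaRight z) (polyaRight w) ^ 2 = dist z w ^ 2 / 2 := by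
  simp only [dist_sq_eq_plane, polyaRight, Matrix.cons_val_zero,
    Matrix.cons_val_one]
  ring

theorem continuous_polyaLeft : Continuous polyaLeft := by
  unfold polyaLeft
  fun_prop

theorem continuous_polyaRight : Continuous polyaRight := by
  unfold polyaRight
  fun_prop

theorem polyaLeft_zero : polyaLeft !₂[0, 0] = !₂[0, 0] := by simp [polyaLeft]

theorem polyaLeft_one : polyaLeft !₂[1, 0] = !₂[1 / 2, 1 / 2] := by simp [polyaLeft]

theorem polyaRight_zero : polyaRight !₂[0, 0] = !₂[1 / 2, 1 / 2] := by simp [polyaRight]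

theorem polyaRight_one : polyaRight !₂[1, 0] = !₂[1, 0] := by norm_num [polyaRight]

theorem polyaLeft_mem {z : EuclideanSpace ℝ (Fin 2)} (hz : z ∈ polyaTriangle) :
    polyaLeft z ∈ polyaTriangle := by
  obtain ⟨h1, h2, h3⟩ := hz
  simp only [polyaTriangle, polyaLeft, mem_ofPred_eq, Matrix.cons_val_zero,
    Matrix.cons_val_one]
  refine ⟨?_, ?_, ?_⟩ <;> linarith

theorem polyaRight_mem {z : EuclideanSpace ℝ (Fin 2)} (hz : z ∈ polyaTriangle) :
    polyaRight z ∈ polyaTriangle := by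
  obtain ⟨h1, h2, h3⟩ := hz
  simp only [polyaTriangle, polyaRight, mem_ofPred_eq, Matrix.cons_val_zero,
    Matrix.cons_val_one]
  refine ⟨?_, ?_, ?_⟩ <;> linarith

theorem exists_polya_eq {z : EuclideanSpace ℝ (Fin 2)} (hz : z ∈ polyaTriangle) :
    ∃ w ∈ polyaTriangle, polyaLeft w = z ∨ polyaRight w = z := by
  obtain ⟨h1, h2, h3⟩ := hz
  rcases le_total (z 0) (1 / 2) with h | h
  · refine ⟨!₂[z 0 + z 1, z 0 - z 1], ?_, Or.inl ?_⟩
    · simp only [polyaTriangle, mem_ofPred_eq, Matrix.cons_val_zero,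
        Matrix.cons_val_one]
      refine ⟨?_, ?_, ?_⟩ <;> linarith
    · ext i
      fin_cases i <;> simp [polyaLeft]
  · refine ⟨!₂[z 0 - z 1, 1 - z 0 - z 1], ?_, Or.inr ?_⟩
    · simp only [polyaTriangle, mem_ofPred_eq, Matrix.cons_val_zero,
        Matrix.cons_val_one]
      refine ⟨?_, ?_, ?_⟩ <;> linarith
    · ext i
      fin_cases i <;> simp [polyaRight] <;> ring

theorem dist_sq_le_of_mem_polyaTriangle {z w : EuclideanSpace ℝ (Fin 2)}
    (hz : z ∈ polyaTriangle) (hw : w ∈ polyaTriangle) : dist z w ^ 2 ≤ 2 := by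
  obtain ⟨h1, h2, h3⟩ := hz
  obtain ⟨k1, k2, k3⟩ := hw
  have a : (z 0 - w 0) ^ 2 ≤ 1 := sq_le_one_iff_abs_le_one _ |>.2
    (abs_le.2 ⟨by linarith, by linarith⟩)
  have b : (z 1 - w 1) ^ 2 ≤ 1 := sq_le_one_iff_abs_le_one _ |>.2
    (abs_le.2 ⟨by linarith, by linarith⟩)
  rw [dist_sq_eq_plane]
  linarith

theorem zero_mem_polyaTriangle : !₂[0, 0] ∈ polyaTriangle := by simp [polyaTriangle]

theorem interior_polyaTriangle_nonempty : (interior polyaTriangle).Nonempty := by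
  have ho : IsOpen {z : EuclideanSpace ℝ (Fin 2) | 0 < z 1 ∧ z 1 < z 0 ∧ z 0 + z 1 < 1} :=
    (isOpen_lt (by fun_prop) (by fun_prop)).and
      ((isOpen_lt (by fun_prop) (by fun_prop)).and (isOpen_lt (by fun_prop) (by fun_prop)))
  refine ⟨!₂[1 / 2, 1 / 4], mem_interior.2 ⟨_, fun z hz ↦ ⟨hz.1.le, hz.2.1.le, hz.2.2.le⟩, ho, ?_⟩⟩
  norm_num

/-- The polygonal approximations of Pólya's curve: the segment `[0, 1]`, and then the images of the
previous curve under the two similarities, one after the other. -/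
noncomputable def polyaIter : ℕ → ℝ → EuclideanSpace ℝ (Fin 2)
  | 0 => fun t ↦ !₂[t, 0]
  | n + 1 => concat (fun t ↦ polyaLeft (polyaIter n t)) (fun t ↦ polyaRight (polyaIter n t))

theorem polyaIter_succ_of_le (n : ℕ) {t : ℝ} (ht : t ≤ 1 / 2) :
    polyaIter (n + 1) t = polyaLeft (polyaIter n (2 * t)) := concat_of_le _ _ ht

theorem polyaIter_succ_of_gt (n : ℕ) {t : ℝ} (ht : 1 / 2 < t) :
    polyaIter (n + 1) t = polyaRight (polyaIter n (2 * t - 1)) := concat_of_gt _ _ ht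

theorem polyaIter_zero_right (n : ℕ) : polyaIter n 0 = !₂[0, 0] := by
  induction n with
  | zero => rfl
  | succ n ih => rw [polyaIter_succ_of_le n (by norm_num), mul_zero, ih, polyaLeft_zero]

theorem polyaIter_one_right (n : ℕ) : polyaIter n 1 = !₂[1, 0] := by
  induction n with
  | zero => rfl
  | succ n ih =>
    rw [polyaIter_succ_of_gt n (by norm_num), show (2 : ℝ) * 1 - 1 = 1 by norm_num, ih,
      polyaRight_one]

theorem polyaIter_mem (n : ℕ) {t : ℝ} (ht : t ∈ Icc (0 : ℝ) 1) : polyaIter n t ∈ polyaTriangle := by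
  induction n generalizing t with
  | zero => simpa [polyaIter, polyaTriangle] using ht
  | succ n ih =>
    rcases le_or_gt t (1 / 2) with h | h
    · rw [polyaIter_succ_of_le n h]
      exact polyaLeft_mem (ih ⟨by linarith [ht.1], by linarith⟩)
    · rw [polyaIter_succ_of_gt n h]
      exact polyaRight_mem (ih ⟨by linarith, by linarith [ht.2]⟩)

theorem dist_polyaIter_zero_sq_le (n : ℕ) {t : ℝ} (ht : t ∈ Icc (0 : ℝ) 1) :
    dist (polyaIter n t) !₂[0, 0] ^ 2 ≤ 2 * t := by
  induction n generalizing t with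
  | zero =>
    rw [dist_sq_eq_plane]
    simp only [polyaIter, Matrix.cons_val_zero, Matrix.cons_val_one]
    nlinarith [ht.1, ht.2]
  | succ n ih =>
    rcases le_or_gt t (1 / 2) with h | h
    · rw [polyaIter_succ_of_le n h, ← polyaLeft_zero, dist_polyaLeft_sq]
      linarith [ih (t := 2 * t) ⟨by linarith [ht.1], by linarith⟩]
    · obtain ⟨h1, h2, h3⟩ := polyaIter_mem (n + 1) ht
      rw [dist_sq_eq_plane]
      simp only [Matrix.cons_val_zero, Matrix.cons_val_one]
      nlinarith

theorem dist_polyaIter_one_sq_le (n : ℕ) {t : ℝ} (ht : t ∈ Icc (0 : ℝ) 1) :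
    dist (polyaIter n t) !₂[1, 0] ^ 2 ≤ 2 * (1 - t) := by
  induction n generalizing t with
  | zero =>
    rw [dist_sq_eq_plane]
    simp only [polyaIter, Matrix.cons_val_zero, Matrix.cons_val_one]
    nlinarith [ht.1, ht.2]
  | succ n ih =>
    rcases le_or_gt t (1 / 2) with h | h
    · obtain ⟨h1, h2, h3⟩ := polyaIter_mem (n + 1) ht
      rw [dist_sq_eq_plane]
      simp only [Matrix.cons_val_zero, Matrix.cons_val_one]
      nlinarith
    · rw [polyaIter_succ_of_gt n h, ← polyaRight_one, dist_polyaRight_sq]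
      linarith [ih (t := 2 * t - 1) ⟨by linarith, by linarith [ht.2]⟩]

/-- The approximations are `1/2`-Hölder, uniformly in `n`. The similarities halve squared distances
while the parameter is halved, so only parameters in different halves lose a factor; there the
estimates at the end points apply, and the loss does not accumulate. -/
theorem dist_polyaIter_sq_le (n : ℕ) {s t : ℝ} (hs : s ∈ Icc (0 : ℝ) 1) (ht : t ∈ Icc (0 : ℝ) 1) :
    dist (polyaIter n s) (polyaIter n t) ^ 2 ≤ 4 * |s - t| := by
  induction n generalizing s t with
  | zero =>
    rw [dist_sq_eq_plane]
    simp only [polyaIter, Matrix.cons_val_zero, Matrix.cons_val_one]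
    have h1 : |s - t| ≤ 1 := abs_le.2 ⟨by linarith [hs.1, ht.2], by linarith [hs.2, ht.1]⟩
    nlinarith [sq_abs (s - t), abs_nonneg (s - t)]
  | succ n ih =>
    wlog hst : s ≤ t generalizing s t
    · rw [dist_comm, abs_sub_comm]
      exact this ht hs (le_of_not_ge hst)
    rcases le_or_gt t (1 / 2) with h | h
    · rw [polyaIter_succ_of_le n h, polyaIter_succ_of_le n (hst.trans h), dist_polyaLeft_sq]
      have := ih (s := 2 * s) (t := 2 * t) ⟨by linarith [hs.1], by linarith⟩
        ⟨by linarith [ht.1], by linarith⟩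
      rw [← mul_sub, abs_mul, abs_two] at this
      linarith
    rcases le_or_gt s (1 / 2) with h' | h'
    · rw [polyaIter_succ_of_gt n h, polyaIter_succ_of_le n h']
      have h1 := dist_polyaIter_one_sq_le n (t := 2 * s) ⟨by linarith [hs.1], by linarith⟩
      have h2 := dist_polyaIter_zero_sq_le n (t := 2 * t - 1) ⟨by linarith, by linarith [ht.2]⟩
      have h3 := dist_sq_le_two_mul (polyaLeft (polyaIter n (2 * s))) !₂[1 / 2, 1 / 2]
        (polyaRight (polyaIter n (2 * t - 1)))
      have h4 := dist_polyaLeft_sq (polyaIter n (2 * s)) !₂[1, 0]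
      have h5 := dist_polyaRight_sq !₂[0, 0] (polyaIter n (2 * t - 1))
      rw [polyaLeft_one] at h4
      rw [polyaRight_zero] at h5
      rw [dist_comm] at h2
      rw [abs_sub_comm, abs_of_nonneg (by linarith)]
      linarith
    · rw [polyaIter_succ_of_gt n h, polyaIter_succ_of_gt n h', dist_polyaRight_sq]
      have := ih (s := 2 * s - 1) (t := 2 * t - 1) ⟨by linarith, by linarith [hs.2]⟩
        ⟨by linarith, by linarith [ht.2]⟩
      rw [sub_sub_sub_cancel_right, ← mul_sub, abs_mul, abs_two] at this
      linarith

theorem dist_polyaIter_succ_sq_le (n : ℕ) {t : ℝ} (ht : t ∈ Icc (0 : ℝ) 1) :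
    dist (polyaIter n t) (polyaIter (n + 1) t) ^ 2 ≤ 2 * (1 / 2) ^ n := by
  induction n generalizing t with
  | zero => simpa using dist_sq_le_of_mem_polyaTriangle (polyaIter_mem 0 ht) (polyaIter_mem 1 ht)
  | succ n ih =>
    rcases le_or_gt t (1 / 2) with h | h
    · rw [polyaIter_succ_of_le n h, polyaIter_succ_of_le (n + 1) h, dist_polyaLeft_sq, pow_succ (1 / 2 : ℝ)]
      linarith [ih (t := 2 * t) ⟨by linarith [ht.1], by linarith⟩]
    · rw [polyaIter_succ_of_gt n h, polyaIter_succ_of_gt (n + 1) h, dist_polyaRight_sq, pow_succ (1 / 2 : ℝ)]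
      linarith [ih (t := 2 * t - 1) ⟨by linarith, by linarith [ht.2]⟩]

theorem exists_tendsto_polyaIter {t : ℝ} (ht : t ∈ Icc (0 : ℝ) 1) :
    ∃ z, Tendsto (fun n ↦ polyaIter n t) atTop (𝓝 z) := by
  refine cauchySeq_tendsto_of_complete (cauchySeq_of_le_geometric (√(1 / 2)) (√2) ?_ fun n ↦ ?_)
  · rw [Real.sqrt_lt' one_pos]; norm_num
  · refine le_of_sq_le_sq ?_ (by positivity)
    rw [mul_pow, ← pow_mul, mul_comm n, pow_mul, Real.sq_sqrt (by norm_num),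
      Real.sq_sqrt (by norm_num)]
    exact dist_polyaIter_succ_sq_le n ht

/-- **Pólya's curve**: a `1/2`-Hölder map from `[0, 1]` onto a triangle. -/
theorem exists_holder_curve_filling_triangle :
    ∃ g : ℝ → EuclideanSpace ℝ (Fin 2),
      (∀ s ∈ Icc (0 : ℝ) 1, ∀ t ∈ Icc (0 : ℝ) 1, dist (g s) (g t) ^ 2 ≤ 4 * |s - t|) ∧
      polyaTriangle ⊆ g '' Icc 0 1 := by
  have H : ∀ t : ℝ, ∃ z, t ∈ Icc (0 : ℝ) 1 → Tendsto (fun n ↦ polyaIter n t) atTop (𝓝 z) := by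
    intro t
    by_cases ht : t ∈ Icc (0 : ℝ) 1
    · obtain ⟨z, hz⟩ := exists_tendsto_polyaIter ht
      exact ⟨z, fun _ ↦ hz⟩
    · exact ⟨0, fun h ↦ absurd h ht⟩
  choose g hg using H
  have hol : ∀ s ∈ Icc (0 : ℝ) 1, ∀ t ∈ Icc (0 : ℝ) 1, dist (g s) (g t) ^ 2 ≤ 4 * |s - t| :=
    fun s hs t ht ↦ le_of_tendsto (((hg s hs).dist (hg t ht)).pow 2)
      (Eventually.of_forall fun n ↦ dist_polyaIter_sq_le n hs ht)
  refine ⟨g, hol, fun z hz ↦ ?_⟩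
  have hleft : ∀ t ∈ Icc (0 : ℝ) 1, g (t / 2) = polyaLeft (g t) := fun t ht ↦ by
    refine tendsto_nhds_unique ((tendsto_add_atTop_iff_nat 1).2
      (hg (t / 2) ⟨by linarith [ht.1], by linarith [ht.2]⟩)) ?_
    refine ((continuous_polyaLeft.tendsto _).comp (hg t ht)).congr fun n ↦ ?_
    rw [polyaIter_succ_of_le n (by linarith [ht.2]), mul_div_cancel₀ t two_ne_zero]
    rfl
  have hright : ∀ t ∈ Icc (0 : ℝ) 1, g ((1 + t) / 2) = polyaRight (g t) := fun t ht ↦ by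
    refine tendsto_nhds_unique ((tendsto_add_atTop_iff_nat 1).2
      (hg ((1 + t) / 2) ⟨by linarith [ht.1], by linarith [ht.2]⟩)) ?_
    refine ((continuous_polyaRight.tendsto _).comp (hg t ht)).congr fun n ↦ ?_
    rw [Function.comp]
    rcases ht.1.eq_or_lt with h | h
    · -- At `t = 0` both halves of the curve pass through the apex.
      subst h
      rw [polyaIter_succ_of_le n (by norm_num), polyaIter_zero_right, polyaRight_zero,
        show (2 : ℝ) * ((1 + 0) / 2) = 1 by norm_num, polyaIter_one_right, polyaLeft_one]
    · rw [polyaIter_succ_of_gt n (by linarith), mul_div_cancel₀ _ two_ne_zero,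
        add_sub_cancel_left]
  have approx : ∀ n : ℕ, ∀ z ∈ polyaTriangle, ∃ t ∈ Icc (0 : ℝ) 1,
      dist z (g t) ^ 2 ≤ 2 * (1 / 2) ^ n := by
    intro n
    induction n with
    | zero =>
      intro z hz
      refine ⟨0, by simp, ?_⟩
      have h0 : g 0 = !₂[0, 0] := tendsto_nhds_unique (hg 0 (by simp))
        (by simp only [polyaIter_zero_right]; exact tendsto_const_nhds)
      rw [h0, pow_zero, mul_one]
      exact dist_sq_le_of_mem_polyaTriangle hz zero_mem_polyaTriangle
    | succ n ih =>
      intro z hz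
      obtain ⟨w, hw, h | h⟩ := exists_polya_eq hz
      · obtain ⟨t, ht, hwt⟩ := ih w hw
        refine ⟨t / 2, ⟨by linarith [ht.1], by linarith [ht.2]⟩, ?_⟩
        rw [hleft t ht, ← h, dist_polyaLeft_sq, pow_succ (1 / 2 : ℝ)]
        linarith
      · obtain ⟨t, ht, hwt⟩ := ih w hw
        refine ⟨(1 + t) / 2, ⟨by linarith [ht.1], by linarith [ht.2]⟩, ?_⟩
        rw [hright t ht, ← h, dist_polyaRight_sq, pow_succ (1 / 2 : ℝ)]
        linarith
  have hcont : ContinuousOn g (Icc 0 1) := by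
    intro t ht
    rw [ContinuousWithinAt, tendsto_iff_dist_tendsto_zero]
    have h1 : Tendsto (fun s ↦ √(4 * |s - t|)) (𝓝[Icc 0 1] t) (𝓝 0) := by
      have : ContinuousAt (fun s ↦ √(4 * |s - t|)) t := by fun_prop
      simpa [ContinuousAt] using this.tendsto.mono_left nhdsWithin_le_nhds
    refine squeeze_zero' (Eventually.of_forall fun _ ↦ dist_nonneg) ?_ h1
    filter_upwards [self_mem_nhdsWithin] with s hs
    exact Real.le_sqrt_of_sq_le (hol s hs t ht)
  have hclosed : IsClosed (g '' Icc 0 1) := (isCompact_Icc.image_of_continuousOn hcont).isClosed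
  rw [← hclosed.closure_eq, Metric.mem_closure_iff]
  intro ε hε
  obtain ⟨n, hn⟩ := exists_pow_lt_of_lt_one (show 0 < ε ^ 2 / 2 by positivity)
    (show (1 / 2 : ℝ) < 1 by norm_num)
  obtain ⟨t, ht, hzt⟩ := approx n z hz
  exact ⟨g t, mem_image_of_mem g ht, lt_of_pow_lt_pow_left₀ 2 hε.le (by linarith)⟩

/-! ### Snowflakes of sets of reals have null images -/

/-- If `G` is biLipschitz on `A` for the snowflake metric `|s - t| ^ (1 / 2)`, then `G '' A` is a
null set. Otherwise it has a density point, near which two points of the image at distance about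
`N * δ` are joined by a chain of `N` points of the image with steps at most `3 * δ`. The parameters
of these points then differ by at most a multiple of `N * δ ^ 2`, but by at least a multiple of
`(N * δ) ^ 2`. -/
theorem measure_image_eq_zero_of_snowflake {E : Type*} [NormedAddCommGroup E] [NormedSpace ℝ E]
    [FiniteDimensional ℝ E] [Nontrivial E] [MeasurableSpace E] [BorelSpace E] (μ : Measure E)
    [μ.IsAddHaarMeasure] {A : Set ℝ} {G : ℝ → E} {a b : ℝ} (ha : 0 ≤ a) (hb : 0 ≤ b)
    (h₁ : ∀ s ∈ A, ∀ t ∈ A, |s - t| ≤ a * dist (G s) (G t) ^ 2)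
    (h₂ : ∀ s ∈ A, ∀ t ∈ A, dist (G s) (G t) ^ 2 ≤ b * |s - t|) :
    μ (G '' A) = 0 := by
  by_contra hμ
  obtain ⟨N, hN⟩ := exists_nat_gt (36 * (a * b) + 8)
  have hab : 0 ≤ a * b := mul_nonneg ha hb
  have hne : (ae (μ.restrict (G '' A))).NeBot :=
    ae_neBot.2 fun h ↦ hμ (Measure.restrict_eq_zero.1 h)
  obtain ⟨x, hx⟩ :=
    (IsUnifLocDoublingMeasure.ae_tendsto_measure_inter_div μ (G '' A) N).exists
  obtain ⟨v, hv⟩ := exists_norm_eq E zero_le_one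
  have key : ∀ i ∈ Finset.range (N + 1), ∀ᶠ δ in 𝓝[>] (0 : ℝ),
      (G '' A ∩ Metric.closedBall (x + ((i : ℝ) * δ) • v) δ).Nonempty := by
    intro i hi
    have hi' : (i : ℝ) ≤ N := by
      exact_mod_cast Nat.lt_succ_iff.1 (Finset.mem_range.1 hi)
    have := hx (l := 𝓝[>] (0 : ℝ)) (fun δ ↦ x + ((i : ℝ) * δ) • v) id tendsto_id (by
      filter_upwards [self_mem_nhdsWithin] with δ hδ
      have hδ' : (0 : ℝ) < δ := hδ
      rw [Metric.mem_closedBall, dist_self_add_right, norm_smul, hv, mul_one, Real.norm_eq_abs,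
        abs_of_nonneg (by positivity)]
      exact mul_le_mul_of_nonneg_right hi' hδ'.le)
    filter_upwards [this.eventually_ne one_ne_zero] with δ hδ
    by_contra he
    rw [not_nonempty_iff_eq_empty] at he
    simp [he] at hδ
  obtain ⟨δ, hδ, hδ0⟩ := (((Finset.range (N + 1)).eventually_all.2 key).and
    self_mem_nhdsWithin).exists
  replace hδ0 : 0 < δ := hδ0
  have : ∀ i : ℕ, ∃ s, i ≤ N → s ∈ A ∧ dist (G s) (x + ((i : ℝ) * δ) • v) ≤ δ := by
    intro i
    by_cases hi : i ≤ N
    · obtain ⟨_, ⟨s, hs, rfl⟩, hd⟩ := hδ i (Finset.mem_range.2 (Nat.lt_succ_iff.2 hi))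
      exact ⟨s, fun _ ↦ ⟨hs, hd⟩⟩
    · exact ⟨0, fun h ↦ absurd h hi⟩
  choose s hs using this
  have hcen : ∀ i j : ℝ, dist (x + (i * δ) • v) (x + (j * δ) • v) = |i - j| * δ := by
    intro i j
    rw [dist_add_left, dist_eq_norm, ← sub_smul, norm_smul, hv, mul_one, ← sub_mul, norm_mul,
      Real.norm_eq_abs, Real.norm_eq_abs, abs_of_pos hδ0]
  have hstep : ∀ {k : ℕ}, k < N → dist (s k) (s (k + 1)) ≤ 9 * a * δ ^ 2 := by
    intro k hk
    have e1 := hs k hk.le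
    have e2 := hs (k + 1) hk
    have e3 := hcen k (k + 1 : ℕ)
    rw [Nat.cast_add, Nat.cast_one, sub_add_cancel_left, abs_neg, abs_one, one_mul] at e3
    rw [Nat.cast_add, Nat.cast_one] at e2
    have e4 : dist (G (s k)) (G (s (k + 1))) ≤ 3 * δ := by
      have := dist_triangle4 (G (s k)) (x + ((k : ℝ) * δ) • v) (x + (((k : ℝ) + 1) * δ) • v)
        (G (s (k + 1)))
      rw [dist_comm (x + (((k : ℝ) + 1) * δ) • v) (G (s (k + 1)))] at this
      linarith [e1.2, e2.2]
    calc dist (s k) (s (k + 1)) ≤ a * dist (G (s k)) (G (s (k + 1))) ^ 2 :=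
          h₁ _ e1.1 _ e2.1
      _ ≤ a * (3 * δ) ^ 2 := by gcongr
      _ = _ := by ring
  have htot := dist_le_range_sum_of_dist_le N hstep
  rw [Finset.sum_const, Finset.card_range, nsmul_eq_mul] at htot
  have hlow : (N - 2 : ℝ) * δ ≤ dist (G (s 0)) (G (s N)) := by
    have e1 := hs 0 (Nat.zero_le _)
    have e2 := hs N le_rfl
    have e3 := hcen (0 : ℕ) N
    rw [Nat.cast_zero, zero_sub, abs_neg, abs_of_nonneg (Nat.cast_nonneg N)] at e3
    rw [Nat.cast_zero] at e1
    have := dist_triangle4 (x + ((0 : ℝ) * δ) • v) (G (s 0)) (G (s N)) (x + ((N : ℝ) * δ) • v)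
    rw [dist_comm (x + ((0 : ℝ) * δ) • v) (G (s 0))] at this
    linarith [e1.2, e2.2]
  have hfin : ((N - 2 : ℝ) * δ) ^ 2 ≤ b * (N * (9 * a * δ ^ 2)) :=
    calc ((N - 2 : ℝ) * δ) ^ 2 ≤ dist (G (s 0)) (G (s N)) ^ 2 :=
          pow_le_pow_left₀ (mul_nonneg (by linarith) hδ0.le) hlow 2
      _ ≤ b * dist (s 0) (s N) := h₂ _ (hs 0 (Nat.zero_le _)).1 _ (hs N le_rfl).1
      _ ≤ _ := by gcongr
  have hfin' : (N - 2 : ℝ) ^ 2 ≤ 9 * (a * b) * N :=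
    le_of_mul_le_mul_right (by linarith) (pow_pos hδ0 2)
  nlinarith

/-! ### Hausdorff dimension and the Lipschitz map -/

namespace GrushinPlane

/-- The point of height `t` on the axis `x = 0`. -/
noncomputable def axis (t : ℝ) : GrushinPlane := ofCoord !₂[0, t]

theorem axis_coord_zero (t : ℝ) : (axis t).coord 0 = 0 := rfl

theorem axis_coord_one (t : ℝ) : (axis t).coord 1 = t := rfl

theorem abs_sub_le_dist_axis_sq (s t : ℝ) : |s - t| ≤ dist (axis s) (axis t) ^ 2 := by
  have := (abs_sub_le_toReal_ccEDist (axis s).coord (axis t).coord).2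
  rw [← dist_eq, axis_coord_zero, axis_coord_one, axis_coord_one, abs_zero, zero_add] at this
  rwa [abs_sub_comm, sq]

theorem dist_axis_le (s t : ℝ) : dist (axis s) (axis t) ≤ 3 * √|s - t| := by
  have h := ccEDist_grushin_le_coord (axis s).coord (axis t).coord
  rw [axis_coord_zero, axis_coord_zero, axis_coord_one, axis_coord_one, sub_zero, abs_zero,
    zero_add] at h
  rw [dist_eq, abs_sub_comm]
  exact ENNReal.toReal_le_of_le_ofReal (by positivity) h

theorem holderWith_axis : HolderWith 3 (1 / 2) axis := by
  intro s t
  rw [edist_dist, edist_dist, Real.dist_eq s t, ENNReal.ofReal_rpow_of_nonneg (abs_nonneg _)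
    (by positivity), show ((3 : ℝ≥0) : ℝ≥0∞) = ENNReal.ofReal 3 by simp,
    ← ENNReal.ofReal_mul (by norm_num)]
  refine ENNReal.ofReal_le_ofReal ((dist_axis_le s t).trans_eq ?_)
  rw [Real.sqrt_eq_rpow]
  norm_num

theorem lipschitzOnWith_ofCoord (n : ℕ) :
    LipschitzOnWith (n + 2) ofCoord {p | 1 / ((n : ℝ) + 1) ≤ |p 0|} := by
  refine LipschitzOnWith.of_dist_le_mul fun p hp q _ ↦ ?_
  have hn : (0 : ℝ) < 1 / ((n : ℝ) + 1) := by positivity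
  have hp' : 1 / ((n : ℝ) + 1) ≤ |p 0| := hp
  have h := ccEDist_grushin_le_of_ne (abs_pos.1 (hn.trans_le hp')) (p 1) (q 0) (q 1)
  rw [← eq_toLp_plane, ← eq_toLp_plane] at h
  rw [dist_eq]
  refine (ENNReal.toReal_le_of_le_ofReal (by positivity) h).trans ?_
  have h0 : |q 0 - p 0| ≤ dist p q := by
    rw [dist_comm, dist_eq_norm]; exact PiLp.norm_apply_le (q - p) 0
  have h1 : |q 1 - p 1| ≤ dist p q := by
    rw [dist_comm, dist_eq_norm]; exact PiLp.norm_apply_le (q - p) 1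
  have h2 : |q 1 - p 1| / |p 0| ≤ dist p q * (n + 1) :=
    calc |q 1 - p 1| / |p 0| ≤ dist p q / (1 / ((n : ℝ) + 1)) := by gcongr
      _ = _ := by rw [one_div, div_inv_eq_mul]
  push_cast
  linarith

/-- The axis is a snowflake of dimension `2`, and off the axis the metric is locally Euclidean up to
constants. -/
theorem dimH_univ_le : dimH (univ : Set GrushinPlane) ≤ 2 := by
  have hcover : (univ : Set GrushinPlane) ⊆
      range axis ∪ ⋃ n : ℕ, ofCoord '' {p | 1 / ((n : ℝ) + 1) ≤ |p 0|} := by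
    intro p _
    by_cases hp : p.coord 0 = 0
    · refine Or.inl ⟨p.coord 1, ?_⟩
      rw [← ofCoord_coord p, axis, eq_toLp_plane p.coord, hp]
      rfl
    · obtain ⟨n, hn⟩ := exists_nat_one_div_lt (abs_pos.2 hp)
      exact Or.inr (mem_iUnion.2 ⟨n, p.coord, hn.le, rfl⟩)
  refine (dimH_mono hcover).trans ?_
  rw [dimH_union, dimH_iUnion]
  refine max_le ?_ (iSup_le fun n ↦ ?_)
  · refine (holderWith_axis.dimH_range_le (by norm_num)).trans ?_
    rw [Real.dimH_univ]
    simp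
  · refine (lipschitzOnWith_ofCoord n).dimH_image_le.trans ((dimH_mono (subset_univ _)).trans ?_)
    rw [Real.dimH_univ_eq_finrank, finrank_euclideanSpace_fin]
    rfl

/-- Any `1/2`-Hölder curve is a Lipschitz function on the axis, and hence extends to a Lipschitz map
on the Grushin plane. -/
theorem exists_lipschitzWith_extension {g : ℝ → EuclideanSpace ℝ (Fin 2)}
    (hg : ∀ s ∈ Icc (0 : ℝ) 1, ∀ t ∈ Icc (0 : ℝ) 1, dist (g s) (g t) ^ 2 ≤ 4 * |s - t|) :
    ∃ (F : GrushinPlane → EuclideanSpace ℝ (Fin 2)) (K : ℝ≥0), LipschitzWith K F ∧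
      ∀ t ∈ Icc (0 : ℝ) 1, F (axis t) = g t := by
  have hL : LipschitzOnWith 2 (fun p : GrushinPlane ↦ (g (p.coord 1)).ofLp)
      (axis '' Icc 0 1) := by
    refine LipschitzOnWith.of_dist_le_mul ?_
    rintro _ ⟨s, hs, rfl⟩ _ ⟨t, ht, rfl⟩
    rw [axis_coord_one, axis_coord_one]
    have h1 : dist (g s) (g t) ≤ 2 * dist (axis s) (axis t) := by
      refine le_of_sq_le_sq ?_ (by positivity)
      rw [mul_pow]
      linarith [hg s hs t ht, abs_sub_le_dist_axis_sq s t]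
    refine ((PiLp.lipschitzWith_ofLp 2 _).dist_le_mul (g s) (g t)).trans ?_
    simpa using h1
  obtain ⟨F, hF, hFg⟩ := hL.extend_pi
  refine ⟨fun p ↦ WithLp.toLp 2 (F p), _, (PiLp.lipschitzWith_toLp 2 _).comp hF, fun t ht ↦ ?_⟩
  exact (congrArg (WithLp.toLp 2) (hFg (mem_image_of_mem axis ht))).symm

end GrushinPlane

instance isAddHaarMeasure_hausdorffMeasure_two :
    (μH[2] : Measure (EuclideanSpace ℝ (Fin 2))).IsAddHaarMeasure := by
  have := isAddHaarMeasure_hausdorffMeasure (E := EuclideanSpace ℝ (Fin 2))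
  rwa [finrank_euclideanSpace_fin, Nat.cast_two] at this

open GrushinPlane in
/-- The images of the axis under the biLipschitz pieces are null sets, so that countably many pieces
cannot exhaust the triangle filled by the image of the axis. -/
theorem not_decomposable {g : ℝ → EuclideanSpace ℝ (Fin 2)}
    (hg : ∀ s ∈ Icc (0 : ℝ) 1, ∀ t ∈ Icc (0 : ℝ) 1, dist (g s) (g t) ^ 2 ≤ 4 * |s - t|)
    (hT : polyaTriangle ⊆ g '' Icc 0 1)
    {U : Set GrushinPlane} (hU : ∀ t ∈ Icc (0 : ℝ) 1, axis t ∈ U)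
    {F : U → EuclideanSpace ℝ (Fin 2)}
    (hF : ∀ t (ht : t ∈ Icc (0 : ℝ) 1), F ⟨axis t, hU t ht⟩ = g t) :
    ¬ ∃ 𝒜 : Set (Set U), 𝒜.Countable ∧ (∀ A ∈ 𝒜, BiLipschitzOn F A) ∧
      μH[2] (F '' (⋃₀ 𝒜)ᶜ) = 0 := by
  rintro ⟨𝒜, hc, hA, h0⟩
  have hpiece : ∀ A ∈ 𝒜,
      μH[2] (g '' {t | ∃ ht : t ∈ Icc (0 : ℝ) 1, (⟨axis t, hU t ht⟩ : U) ∈ A}) = 0 := by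
    intro A hAm
    obtain ⟨-, L, -, hL⟩ := hA A hAm
    refine measure_image_eq_zero_of_snowflake _ (sq_nonneg (L : ℝ)) (by norm_num : (0 : ℝ) ≤ 4)
      ?_ fun s hs t ht ↦ hg s hs.1 t ht.1
    rintro s ⟨hs, hsA⟩ t ⟨ht, htA⟩
    have h1 := hL.le_mul_dist ⟨_, hsA⟩ ⟨_, htA⟩
    simp only [Set.domRestrict_apply, Subtype.dist_eq] at h1
    rw [hF s hs, hF t ht] at h1
    calc |s - t| ≤ dist (axis s) (axis t) ^ 2 := abs_sub_le_dist_axis_sq s t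
      _ ≤ (L * dist (g s) (g t)) ^ 2 := by gcongr
      _ = _ := mul_pow _ _ _
  have hcover : polyaTriangle ⊆ F '' (⋃₀ 𝒜)ᶜ ∪
      ⋃ A ∈ 𝒜, g '' {t | ∃ ht : t ∈ Icc (0 : ℝ) 1, (⟨axis t, hU t ht⟩ : U) ∈ A} := by
    intro z hz
    obtain ⟨t, ht, rfl⟩ := hT hz
    by_cases h : (⟨axis t, hU t ht⟩ : U) ∈ ⋃₀ 𝒜
    · obtain ⟨A, hAm, htA⟩ := h
      exact Or.inr (mem_iUnion₂.2 ⟨A, hAm, t, ⟨ht, htA⟩, rfl⟩)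
    · exact Or.inl ⟨_, h, hF t ht⟩
  have hnull : μH[2] polyaTriangle = 0 :=
    measure_mono_null hcover (measure_union_null h0 ((measure_biUnion_null_iff hc).2 hpiece))
  exact (Measure.measure_pos_of_nonempty_interior _ interior_polyaTriangle_nonempty).ne' hnull

end SubRiem

theorem theorem4p2 :
    ∃ (M : Type) (_ : MetricSpace M) (_ : ChartedSpace (EuclideanSpace ℝ (Fin 2)) M)
      (X : Fin 2 → (p : M) → TangentSpace (𝓡 2) p),
      SubRiem.IsSubRiemannianManifold X ∧ SubRiem.IsGrushin X ∧
      dimH (Set.univ : Set M) = 2 ∧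
      ∃ (U : Set M) (F : U → EuclideanSpace ℝ (Fin 2)),
        IsOpen U ∧ (∃ K : ℝ≥0, LipschitzWith K F) ∧
        ¬ ∃ 𝒜 : Set (Set U), 𝒜.Countable ∧
            (∀ A ∈ 𝒜, SubRiem.BiLipschitzOn F A) ∧
            μH[2] (F '' (⋃₀ 𝒜)ᶜ) = 0 := by
  obtain ⟨g, hg, hT⟩ := SubRiem.exists_holder_curve_filling_triangle
  obtain ⟨F, K, hF, hFg⟩ := SubRiem.GrushinPlane.exists_lipschitzWith_extension hg
  refine ⟨SubRiem.GrushinPlane, inferInstance, inferInstance, SubRiem.GrushinPlane.frame,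
    SubRiem.isSubRiemannianManifold_grushinPlane, SubRiem.isGrushin_grushinPlane,
    le_antisymm SubRiem.GrushinPlane.dimH_univ_le ?_, univ, fun p ↦ F p, isOpen_univ,
    ⟨K * 1, hF.comp (LipschitzWith.subtype_val _)⟩,
    SubRiem.not_decomposable hg hT (fun _ _ ↦ mem_univ _) hFg⟩
  -- The Lipschitz image `range F` contains a triangle.
  have hsub : SubRiem.polyaTriangle ⊆ range F := fun z hz ↦ by
    obtain ⟨t, ht, rfl⟩ := hT hz
    exact ⟨_, hFg t ht⟩
  have hdim := Real.dimH_of_nonempty_interior SubRiem.interior_polyaTriangle_nonempty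
  rw [finrank_euclideanSpace_fin, Nat.cast_two] at hdim
  rw [← hdim]
  exact (dimH_mono hsub).trans hF.dimH_range_le
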